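/- Let $p,q\ge 3$. In the game $BS_2(\mathcal P_4:p,q)$, two spots are drawn in the plane, the first with $p$ and the second with $q$ open tips. Two players move alternately. A move joins two open tips by a curve that crosses nothing drawn so far and then puts a crossbar on this curve; the point where they meet becomes a new vertex, and the crossbar provides two new open tips, one on each side of the curve. After each move, the graph whose vertices are the spots and the intersections of curves and crossbars, and whose edges are the parts of the curves joining two such vertices, has to be a planar graph of girth at least $4$ (no loops, no parallel edges, no triangles). A player who cannot move loses. The nimber of a position is the least non-negative integer that is not the nimber of a position reached from it by one move. Then the nimber of $BS_2(\mathcal P_4:p,q)$ is $0$. Moreover, the first move is unique up to symmetry, and the second player can reply to it so as to reach a position of nimber $0$. -/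

import Mathlib

namespace BrusselsSprout

/-! ### Nimbers of impartial games -/

/-- `HasNimber move x n`: the game tree of the impartial game with moves `move` and starting
position `x` is well-founded, and the nimber of `x` is `n`, that is, `n` is the least natural
number that is not the nimber of a child of `x`. (`g` lists the nimbers of the children; a
position without a move has nimber `0`.) -/
inductive HasNimber {α : Type*} (move : α → α → Prop) : α → ℕ → Prop
  | mk (x : α) (n : ℕ) (g : α → ℕ)
      (children : ∀ y, move x y → HasNimber move y (g y))
      (below : ∀ m, m < n → ∃ y, move x y ∧ g y = m)
      (avoid : ∀ y, move x y → g y ≠ n) : HasNimber move x n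

/-! ### Girth of multigraphs -/

/-- A (multi)graph has girth at least `g` if each of its cycles has length at least `g`. A cycle
of length `k ≥ 1` consists of `k` distinct vertices and `k` distinct edges; loops are cycles of
length `1` and pairs of parallel edges are cycles of length `2`. A graph without cycles has
infinite girth. -/
def GirthAtLeast {α β : Type*} (g : ℕ) (G : Graph α β) : Prop :=
  ∀ k : ℕ, 0 < k → ∀ (v : ZMod k → α) (e : ZMod k → β),
    Function.Injective v → Function.Injective e →
      (∀ i, G.IsLink (e i) (v i) (v (i + 1))) → g ≤ k

/-! ### Positions -/

/-- A position of the generalized Brussels sprout game: a crossing-free drawing in the (oriented)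
plane of a multigraph with open tips, recorded as far as it determines the graph and the further
moves.

* The vertices (the spots, and the points where a crossbar meets a curve) are
  `0, …, numVertices - 1`.
* `edges` is the multiset of edges, each given by its two ends.
* `regions` is the multiset of the regions (the components of the complement of the drawing). A
  region is the multiset of the components of its boundary, one for each connected component of
  the drawing that touches the region. A boundary component is recorded as the cyclic sequence of
  the open tips met when one travels once along it with the region on the left-hand side; each tip
  is recorded by the vertex to which it is attached. -/
@[ext] structure Position where
  numVertices : ℕ
  edges : Multiset (Sym2 ℕ)
  regions : Multiset (Multiset (Cycle ℕ))

/-- The multigraph that underlies a position; `(s(u, v), k)` is the `k`-th edge between `u`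
and `v`. -/
def Position.graph (P : Position) : Graph ℕ (Sym2 ℕ × ℕ) where
  vertexSet := {u | u < P.numVertices}
  IsLink e u v :=
    e.1 = s(u, v) ∧ e.2 < P.edges.count e.1 ∧ u < P.numVertices ∧ v < P.numVertices
  isLink_symm := by
    intro e _
    constructor
    rintro x y ⟨h, hc, hx, hy⟩
    exact ⟨h.trans Sym2.eq_swap, hc, hy, hx⟩
  eq_or_eq_of_isLink_of_isLink := by
    rintro e x y v w ⟨h, -⟩ ⟨h', -⟩
    have h2 : s(x, y) = s(v, w) := h.symm.trans h'
    rw [Sym2.eq_iff] at h2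
    tauto
  left_mem_of_isLink := by
    rintro e x y ⟨-, -, hx, -⟩
    exact hx

/-- The initial position with `n` spots, the `i`-th of which has `t i` open tips. There is one
region, and each spot (with its tips) is a boundary component of it. -/
def start {n : ℕ} (t : Fin n → ℕ) : Position where
  numVertices := n
  edges := 0
  regions :=
    {(Finset.univ : Finset (Fin n)).val.map fun i => (List.replicate (t i) (i : ℕ) : Cycle ℕ)}

/-! ### Moves -/

/-- Joining two open tips, attached to vertices `a` and `b`, by a curve that crosses nothing (and
hence runs inside one region), and drawing a crossbar on the curve. The crossbar creates the new
vertex `n`, adjacent to `a` and `b`, and one new open tip on each side of the curve.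

* `split`: the two tips lie on the same boundary component, which is met in the cyclic order
  `a, A, b, B`. The curve cuts the region into two; one of them is bounded by `A` followed by a
  new tip, the other one by `B` followed by a new tip. Depending on how the curve is drawn, the
  other boundary components of the region are distributed arbitrarily (`K` and `L`) among the two
  new regions.
* `merge`: the two tips lie on different boundary components `a, A` and `b, B` of a region. The
  curve merges them into one, along which one meets a new tip, `A`, the other new tip, `B`. -/
inductive Join : Position → Position → Prop
  | split (n : ℕ) (E : Multiset (Sym2 ℕ)) (R : Multiset (Multiset (Cycle ℕ)))
      (K L : Multiset (Cycle ℕ)) (a b : ℕ) (A B : List ℕ) :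
      Join
        ⟨n, E, (((a :: A ++ b :: B : List ℕ) : Cycle ℕ) ::ₘ (K + L)) ::ₘ R⟩
        ⟨n + 1, s(a, n) ::ₘ s(n, b) ::ₘ E,
          (((n :: A : List ℕ) : Cycle ℕ) ::ₘ K) ::ₘ (((n :: B : List ℕ) : Cycle ℕ) ::ₘ L) ::ₘ R⟩
  | merge (n : ℕ) (E : Multiset (Sym2 ℕ)) (R : Multiset (Multiset (Cycle ℕ)))
      (K : Multiset (Cycle ℕ)) (a b : ℕ) (A B : List ℕ) :
      Join
        ⟨n, E, (((a :: A : List ℕ) : Cycle ℕ) ::ₘ ((b :: B : List ℕ) : Cycle ℕ) ::ₘ K) ::ₘ R⟩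
        ⟨n + 1, s(a, n) ::ₘ s(n, b) ::ₘ E,
          (((n :: A ++ n :: B : List ℕ) : Cycle ℕ) ::ₘ K) ::ₘ R⟩

/-- The valid moves of Brussels sprout, drawn in the plane, for a class `F` of multigraphs: two
open tips are joined, and the graph of the drawing has to remain in `F`. -/
def Move (F : Set (Graph ℕ (Sym2 ℕ × ℕ))) (P Q : Position) : Prop :=
  Join P Q ∧ Q.graph ∈ F

/-- The class of graphs of girth at least `g`. As a position is a crossing-free drawing in the
plane, its graph lies in this class if and only if it is a planar graph of girth at least `g`;
for `g = 4`, a triangle-free planar (simple) graph. -/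
def girthClass (g : ℕ) : Set (Graph ℕ (Sym2 ℕ × ℕ)) :=
  {G | GirthAtLeast g G}

end BrusselsSprout

namespace BrusselsSprout

/-! ### Nimbers -/

/-! A legal curve joins distinct, non-adjacent vertices, so the first move must join the two spots.
The second player joins them again, closing a 4-cycle through the crossbar vertices `2` and `3`
whose sides each keep the spare tips of only one spot `x`. On each side `x` is adjacent to `2` and
`3`, so only `2` and `3` can be joined; the new vertex can then be joined once to `x`, and nothing
remains. Thus each side lasts exactly two moves and the reply has nimber `4 % 2 = 0`
(`PositionLasts.hasNimber`). The position before it therefore has nonzero nimber, and the start,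
with that as its only option, has nimber `0`. -/

theorem HasNimber.unique {α : Type*} {move : α → α → Prop} {x : α} {m n : ℕ}
    (hm : HasNimber move x m) (hn : HasNimber move x n) : m = n := by
  induction hm generalizing n with
  | mk x m g children below avoid ih =>
    cases hn with
    | mk _ _ g' children' below' avoid' =>
      rcases lt_trichotomy m n with h | h | h
      · obtain ⟨y, hy, rfl⟩ := below' m h
        exact absurd (ih y hy (children' y hy)) (avoid y hy)
      · exact h
      · obtain ⟨y, hy, rfl⟩ := below n h
        exact absurd (ih y hy (children' y hy)).symm (avoid' y hy)

/-- If a natural number decreases along the moves, the nimber exists. -/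
theorem exists_hasNimber {α : Type*} {move : α → α → Prop} (I : α → Prop) (μ : α → ℕ)
    (hI : ∀ x y, I x → move x y → I y ∧ μ y < μ x) (x : α) (hx : I x) :
    ∃ n, n ≤ μ x ∧ HasNimber move x n := by
  classical
  induction hk : μ x using Nat.strong_induction_on generalizing x with
  | _ k ih =>
    subst hk
    have hchild : ∀ y, move x y → ∃ n, n ≤ μ y ∧ HasNimber move y n := fun y hy =>
      ih (μ y) (hI x y hx hy).2 y (hI x y hx hy).1 rfl
    choose! g hg using hchild
    -- The options have nimbers at most `μ y < μ x`, so `μ x` itself is excluded.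
    have hex : ∃ n, ∀ y, move x y → g y ≠ n := ⟨μ x, fun y hy => by
      have h1 := (hg y hy).1
      have h2 := (hI x y hx hy).2
      omega⟩
    refine ⟨Nat.find hex, Nat.find_min' hex fun y hy => ?_,
      .mk x _ g (fun y hy => (hg y hy).2) (fun m hm => ?_) (Nat.find_spec hex)⟩
    · have h1 := (hg y hy).1
      have h2 := (hI x y hx hy).2
      omega
    · simpa using Nat.find_min hex hm

/-- If every play from `x` lasts exactly `k` moves, then the nimber of `x` is the parity
of `k`. -/
theorem hasNimber_mod_two {α : Type*} {move : α → α → Prop} (S : ℕ → α → Prop)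
    (hmove : ∀ k x y, S k x → move x y → ∃ j, k = j + 1 ∧ S j y)
    (hex : ∀ k x, S (k + 1) x → ∃ y, move x y) (k : ℕ) (x : α) (hx : S k x) :
    HasNimber move x (k % 2) := by
  induction k generalizing x with
  | zero =>
    refine .mk x _ (fun _ => 0) (fun y hy => ?_) (fun m hm => by omega) fun y hy => ?_ <;>
    · obtain ⟨j, hj, -⟩ := hmove _ _ _ hx hy
      omega
  | succ k ih =>
    refine .mk x _ (fun _ => k % 2) (fun y hy => ?_) (fun m hm => ?_) fun y hy => by omega
    · obtain ⟨j, hj, hy'⟩ := hmove _ _ _ hx hy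
      obtain rfl : k = j := by omega
      exact ih y hy'
    · obtain ⟨y, hy⟩ := hex k x hx
      exact ⟨y, hy, by omega⟩

/-! ### Triangle-free graphs given by lists of edges -/

/-- The edges `E` form a triangle-free simple graph on the vertices `0, …, n - 1`. (A loop is a
degenerate closed walk of length `3`.) -/
structure TriangleFree (n : ℕ) (E : Multiset (Sym2 ℕ)) : Prop where
  nodup : E.Nodup
  lt : ∀ u v, s(u, v) ∈ E → u < n
  triangle : ∀ u v w, s(u, v) ∈ E → s(v, w) ∈ E → s(u, w) ∉ E

/-- The edges after a move that joins `a` and `b` by a curve with new vertex `n`. -/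
abbrev subdivide (n : ℕ) (E : Multiset (Sym2 ℕ)) (a b : ℕ) : Multiset (Sym2 ℕ) :=
  s(a, n) ::ₘ s(n, b) ::ₘ E

theorem mem_subdivide {n : ℕ} {E : Multiset (Sym2 ℕ)} {a b u v : ℕ} :
    s(u, v) ∈ subdivide n E a b ↔ (u = a ∧ v = n ∨ u = n ∧ v = a) ∨
      (u = n ∧ v = b ∨ u = b ∧ v = n) ∨ s(u, v) ∈ E := by
  simp only [Multiset.mem_cons, Sym2.eq_iff]

/-- Without repeated edges every edge index is `0`, so a 2-cycle would use one edge twice; loops and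
3-cycles contradict `triangle`. -/
theorem TriangleFree.graph_mem {P : Position} (h : TriangleFree P.numVertices P.edges) :
    P.graph ∈ girthClass 4 := by
  intro k hk v e hv he hl
  by_contra hk4
  have hmem : ∀ i, s(v i, v (i + 1)) ∈ P.edges := fun i => by
    obtain ⟨h1, h2, -⟩ := hl i
    rw [← h1, ← Multiset.count_pos]
    omega
  have hsnd : ∀ i, (e i).2 = 0 := fun i => by
    have h2 := (hl i).2.1
    have := Multiset.nodup_iff_count_le_one.1 h.nodup (e i).1
    omega
  have hfst : ∀ i, (e i).1 = s(v i, v (i + 1)) := fun i => (hl i).1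
  interval_cases k
  · have h0 := hmem 0
    rw [show (0 + 1 : ZMod 1) = 0 from rfl] at h0
    exact h.triangle _ _ _ h0 h0 h0
  · have : (0 : ZMod 2) = 1 := he (Prod.ext (by
      rw [hfst, hfst, show (1 + 1 : ZMod 2) = 0 from rfl, zero_add, Sym2.eq_swap]) (by
      rw [hsnd, hsnd]))
    exact absurd this (by decide)
  · have h0 := hmem 0
    have h1 := hmem 1
    have h2 := hmem 2
    rw [show (0 + 1 : ZMod 3) = 1 from rfl] at h0
    rw [show (1 + 1 : ZMod 3) = 2 from rfl] at h1
    rw [show (2 + 1 : ZMod 3) = 0 from rfl, Sym2.eq_swap] at h2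
    exact h.triangle _ _ _ h0 h1 h2

/-- The only neighbours of `n` are `a` and `b`, so a triangle through `n` would need the edge `s(a,
b)`. -/
theorem TriangleFree.subdivide {n : ℕ} {E : Multiset (Sym2 ℕ)} (h : TriangleFree n E) {a b : ℕ}
    (ha : a < n) (hb : b < n) (hab : a ≠ b) (hE : s(a, b) ∉ E) :
    TriangleFree (n + 1) (subdivide n E a b) := by
  have hlt := h.lt
  have hlt' : ∀ u v, s(u, v) ∈ E → v < n := fun u v huv => h.lt v u (Sym2.eq_swap ▸ huv)
  have hE' : s(b, a) ∉ E := Sym2.eq_swap ▸ hE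
  refine ⟨?_, ?_, ?_⟩
  · simp only [Multiset.nodup_cons, Multiset.mem_cons, not_or]
    refine ⟨⟨?_, fun hn => (hlt' _ _ hn).ne rfl⟩, fun hn => (hlt _ _ hn).ne rfl, h.nodup⟩
    simp only [Sym2.eq_iff]
    omega
  · intro u v
    simp only [Multiset.mem_cons, Sym2.eq_iff]
    rintro (h1 | h1 | h1)
    · omega
    · omega
    · exact (hlt _ _ h1).trans n.lt_succ_self
  · have htri := h.triangle
    simp only [mem_subdivide]
    generalize hM : (fun u v => s(u, v) ∈ E) = M
    have hM' : ∀ u v, s(u, v) ∈ E ↔ M u v := fun u v => by rw [← hM]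
    clear hM
    simp only [hM'] at *
    rintro u v w (h1 | h1 | h1) (h2 | h2 | h2) (h3 | h3 | h3) <;> grind

/-- A valid move joins two distinct vertices that are not adjacent. -/
theorem ne_and_notMem_of_graph_mem {n : ℕ} {E : Multiset (Sym2 ℕ)}
    {R : Multiset (Multiset (Cycle ℕ))} {a b : ℕ} (ha : a < n) (hb : b < n)
    (h : Position.graph ⟨n + 1, subdivide n E a b, R⟩ ∈ girthClass 4) :
    a ≠ b ∧ s(a, b) ∉ E := by
  have hne : a ≠ b := by
    rintro rfl
    -- The two halves of the curve would be parallel edges, a 2-cycle.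
    have hc : 2 ≤ (subdivide n E a a).count s(a, n) := by
      rw [subdivide, Sym2.eq_swap (a := n), Multiset.count_cons_self, Multiset.count_cons_self]
      omega
    have hv : Function.Injective (![a, n] : Fin 2 → ℕ) := by
      intro i j
      fin_cases i <;> fin_cases j <;> simp [ha.ne, ha.ne']
    have he : Function.Injective (![(s(a, n), 0), (s(a, n), 1)] : Fin 2 → Sym2 ℕ × ℕ) := by
      intro i j
      fin_cases i <;> fin_cases j <;> simp
    have hl : ∀ i : Fin 2, (Position.graph ⟨n + 1, subdivide n E a a, R⟩).IsLink
        ((![(s(a, n), 0), (s(a, n), 1)] : Fin 2 → Sym2 ℕ × ℕ) i) ((![a, n] : Fin 2 → ℕ) i)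
        ((![a, n] : Fin 2 → ℕ) (i + 1)) := by
      rw [Fin.forall_fin_two]
      exact ⟨⟨rfl, (by omega : 0 < (subdivide n E a a).count s(a, n)), ha.trans n.lt_succ_self,
        n.lt_succ_self⟩, ⟨Sym2.eq_swap, hc, n.lt_succ_self, ha.trans n.lt_succ_self⟩⟩
    exact absurd (h 2 two_pos ![a, n] _ hv he hl) (by omega)
  refine ⟨hne, fun hE => ?_⟩
  have hv : Function.Injective (![a, n, b] : Fin 3 → ℕ) := by
    intro i j
    fin_cases i <;> fin_cases j <;> simp [ha.ne, ha.ne', hb.ne, hb.ne', hne, hne.symm]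
  have he : Function.Injective
      (![(s(a, n), 0), (s(n, b), 0), (s(a, b), 0)] : Fin 3 → Sym2 ℕ × ℕ) := by
    intro i j
    fin_cases i <;> fin_cases j <;> simp [ha.ne, ha.ne', hb.ne, hb.ne', hne, hne.symm]
  have hl : ∀ i : Fin 3, (Position.graph ⟨n + 1, subdivide n E a b, R⟩).IsLink
      ((![(s(a, n), 0), (s(n, b), 0), (s(a, b), 0)] : Fin 3 → Sym2 ℕ × ℕ) i)
      ((![a, n, b] : Fin 3 → ℕ) i) ((![a, n, b] : Fin 3 → ℕ) (i + 1)) := by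
    have hcount : ∀ e ∈ subdivide n E a b, 0 < (subdivide n E a b).count e :=
      fun e => Multiset.count_pos.2
    have ha' := ha.trans n.lt_succ_self
    have hb' := hb.trans n.lt_succ_self
    rw [Fin.forall_fin_succ, Fin.forall_fin_two]
    exact ⟨⟨rfl, hcount _ (by simp), ha', n.lt_succ_self⟩,
      ⟨rfl, hcount _ (by simp), n.lt_succ_self, hb'⟩,
      ⟨Sym2.eq_swap, hcount s(a, b) (by simp [hE]), hb', ha'⟩⟩
  exact absurd (h 3 three_pos ![a, n, b] _ hv he hl) (by omega)

/-! ### Regions in which the number of further moves is determined -/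

/-- In a region with the single boundary component `c`, every play lasts exactly `w` moves. -/
inductive Lasts (E : Multiset (Sym2 ℕ)) : Cycle ℕ → ℕ → Prop
  | dead (c : Cycle ℕ) (h : ∀ x ∈ c, ∀ y ∈ c, x = y ∨ s(x, y) ∈ E) : Lasts E c 0
  | one (u x k : ℕ) (hne : u ≠ x) (h : s(u, x) ∉ E) :
      Lasts E (u :: List.replicate (k + 1) x : List ℕ) 1
  -- Since `b` and `a` are consecutive, joining them leaves all the tips at `x` on one side; `k + 1`
  -- ensures that there is one for the second move.
  | two (a b x k : ℕ) (hne : a ≠ b) (h : s(a, b) ∉ E) (ha : s(a, x) ∈ E) (hb : s(b, x) ∈ E)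
      (hax : a ≠ x) (hbx : b ≠ x) :
      Lasts E (b :: a :: List.replicate (k + 1) x : List ℕ) 2

/-- Regions are independent: every new edge ends at `n`, so adjacency among the vertices on `c` is
unchanged. -/
theorem Lasts.subdivide {n : ℕ} {E : Multiset (Sym2 ℕ)} {c : Cycle ℕ} {w : ℕ} (h : Lasts E c w)
    (hc : ∀ x ∈ c, x < n) (a b : ℕ) : Lasts (subdivide n E a b) c w := by
  have hold : ∀ u v, u < n → v < n → s(u, v) ∉ E → s(u, v) ∉ BrusselsSprout.subdivide n E a b := by
    intro u v hu hv huv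
    rw [mem_subdivide]
    rintro (h | h | h)
    · omega
    · omega
    · exact huv h
  have hmono : ∀ e ∈ E, e ∈ BrusselsSprout.subdivide n E a b := fun e he => by simp [he]
  cases h with
  | dead _ h => exact .dead _ fun x hx y hy => (h x hx y hy).imp_right (hmono _)
  | one u x k hne h =>
    exact .one u x k hne (hold _ _ (hc _ (by simp)) (hc _ (by simp)) h)
  | two a' b' x k hne h ha hb hax hbx =>
    exact .two a' b' x k hne (hold _ _ (hc _ (by simp)) (hc _ (by simp)) h) (hmono _ ha)
      (hmono _ hb) hax hbx

/-- If the new vertex is adjacent to the only old vertex with tips on the boundary of a region,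
then the region admits no more moves. -/
theorem Lasts.of_forall_eq {n : ℕ} {E : Multiset (Sym2 ℕ)} {x : ℕ} {A : List ℕ}
    (hA : ∀ y ∈ A, y = x) (h : s(n, x) ∈ E) : Lasts E (n :: A : List ℕ) 0 := by
  refine .dead _ fun y hy z hz => ?_
  simp only [Cycle.mem_coe_iff, List.mem_cons] at hy hz
  have h' : s(x, n) ∈ E := Sym2.eq_swap ▸ h
  grind

theorem Lasts.singleton (E : Multiset (Sym2 ℕ)) (n : ℕ) : Lasts E ([n] : List ℕ) 0 :=
  .dead _ (by simp)

/-- A move in a region that lasts `w` moves creates two regions that together last `w - 1`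
moves. -/
theorem Lasts.split {n : ℕ} {E : Multiset (Sym2 ℕ)} (htri : TriangleFree n E) {a b w : ℕ}
    {A B : List ℕ} (h : Lasts E (a :: A ++ b :: B : List ℕ) w)
    (hlt : ∀ x ∈ ((a :: A ++ b :: B : List ℕ) : Cycle ℕ), x < n)
    (hab : a ≠ b) (hE : s(a, b) ∉ E) :
    ∃ i j, w = i + j + 1 ∧ Lasts (BrusselsSprout.subdivide n E a b) (n :: A : List ℕ) i ∧
      Lasts (BrusselsSprout.subdivide n E a b) (n :: B : List ℕ) j := by
  have hna : s(n, a) ∈ BrusselsSprout.subdivide n E a b := by simp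
  have hnb : s(n, b) ∈ BrusselsSprout.subdivide n E a b := by simp
  generalize hc : ((a :: A ++ b :: B : List ℕ) : Cycle ℕ) = c at h hlt
  cases h with
  | dead _ h =>
    subst hc
    rcases h a (by simp) b (by simp) with h | h
    · exact absurd h hab
    · exact absurd h hE
  | one u x k hne h =>
    -- Counting tips suffices here: `u` occurs once and is used up, so `A` and `B` contain only `x`.
    have hp := (Cycle.coe_eq_coe.1 hc).perm
    have hu := hp.count_eq u
    have hmem := fun y => hp.mem_iff (a := y)
    simp only [List.cons_append, List.count_cons, List.count_append, List.count_replicate,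
      List.mem_cons, List.mem_append, List.mem_replicate, beq_iff_eq] at hu hmem
    have hends : (a = u ∧ b = x) ∨ (a = x ∧ b = u) := by
      have ha := (hmem a).1 (by simp)
      have hb := (hmem b).1 (by simp)
      omega
    have huA : u ∉ A ∧ u ∉ B := by
      simp only [← List.count_eq_zero]
      rcases hends with ⟨rfl, rfl⟩ | ⟨rfl, rfl⟩ <;> simp [hne.symm] at hu ⊢ <;> omega
    have hA : ∀ y ∈ A, y = x := fun y hy =>
      (((hmem y).1 (by simp [hy])).resolve_left fun h => huA.1 (h ▸ hy)).2
    have hB : ∀ y ∈ B, y = x := fun y hy =>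
      (((hmem y).1 (by simp [hy])).resolve_left fun h => huA.2 (h ▸ hy)).2
    have hnx : s(n, x) ∈ BrusselsSprout.subdivide n E a b := by
      rcases hends with ⟨rfl, rfl⟩ | ⟨rfl, rfl⟩ <;> assumption
    exact ⟨0, 0, rfl, .of_forall_eq hA hnx, .of_forall_eq hB hnx⟩
  | two a' b' x k hne h ha' hb' hax hbx =>
    have hp := (Cycle.coe_eq_coe.1 hc).perm
    have hu := hp.count_eq a'
    have hv := hp.count_eq b'
    have hlen := hp.length_eq
    have hmem := fun y => hp.mem_iff (a := y)
    have hxn : x < n := hlt x (by simp)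
    simp only [List.cons_append, List.count_cons, List.count_append, List.count_replicate,
      List.mem_cons, List.mem_append, List.mem_replicate, beq_iff_eq, List.length_cons,
      List.length_append, List.length_replicate] at hu hv hmem hlen
    have hE' : s(b, a) ∉ E := Sym2.eq_swap ▸ hE
    have hends : (a = a' ∧ b = b') ∨ (a = b' ∧ b = a') := by
      have ha := (hmem a).1 (by simp)
      have hb := (hmem b).1 (by simp)
      rcases ha with rfl | rfl | ⟨-, rfl⟩ <;> rcases hb with rfl | rfl | ⟨-, rfl⟩ <;> simp_all
    have huA : (a' ∉ A ∧ a' ∉ B) ∧ b' ∉ A ∧ b' ∉ B := by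
      simp only [← List.count_eq_zero]
      rcases hends with ⟨rfl, rfl⟩ | ⟨rfl, rfl⟩ <;>
        simp [hab, hab.symm, hax.symm, hbx.symm] at hu hv ⊢ <;> omega
    have hA : ∀ y ∈ A, y = x := fun y hy =>
      ((((hmem y).1 (by simp [hy])).resolve_left fun h => huA.2.1 (h ▸ hy)).resolve_left
        fun h => huA.1.1 (h ▸ hy)).2
    have hB : ∀ y ∈ B, y = x := fun y hy =>
      ((((hmem y).1 (by simp [hy])).resolve_left fun h => huA.2.2 (h ▸ hy)).resolve_left
        fun h => huA.1.2 (h ▸ hy)).2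
    have hnx : n ≠ x := hxn.ne'
    have hnx' : s(n, x) ∉ BrusselsSprout.subdivide n E a b := by
      have hlt' : s(n, x) ∉ E := fun hn => (htri.lt _ _ hn).ne rfl
      rw [mem_subdivide]
      grind only
    -- Counting no longer suffices. That `b'` is always followed by `a'` is invariant under
    -- rotation, and forces one of `A`, `B` to be empty.
    have hchain : Cycle.Chain (fun y z => y = b' → z = a')
        ((b' :: a' :: List.replicate (k + 1) x : List ℕ) : Cycle ℕ) := by
      rw [Cycle.chain_coe_cons]
      refine List.IsChain.cons_cons (fun _ => rfl) ?_
      have hrep : ∀ y, y ≠ b' → ∀ m, List.IsChain (fun y z => y = b' → z = a')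
          (y :: (List.replicate m x ++ [b'])) := by
        intro y hy m
        induction m generalizing y with
        | zero => simp [hy]
        | succ m ih =>
          rw [List.replicate_succ, List.cons_append]
          exact .cons_cons (fun h => absurd h hy) (ih x hbx.symm)
      exact hrep a' hne _
    rw [← hc, List.cons_append, Cycle.chain_coe_cons] at hchain
    rcases hends with ⟨rfl, rfl⟩ | ⟨rfl, rfl⟩
    · have hBnil : B = [] := by
        cases B with
        | nil => rfl
        | cons y B =>
          have : y = a := by
            simp only [List.append_assoc, List.cons_append] at hchain
            rw [← List.cons_append, List.isChain_append_cons_cons] at hchain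
            exact hchain.2.1 rfl
          grind
      subst hBnil
      obtain rfl : A = List.replicate (k + 1) x :=
        List.eq_replicate_iff.2 ⟨by simpa using hlen, hA⟩
      exact ⟨1, 0, rfl, .one n x k hnx hnx', .singleton _ n⟩
    · have hAnil : A = [] := by
        cases A with
        | nil => rfl
        | cons y A =>
          have : y = b := by
            simp only [List.cons_append, List.isChain_cons_cons] at hchain
            exact hchain.1 trivial
          grind
      subst hAnil
      obtain rfl : B = List.replicate (k + 1) x :=
        List.eq_replicate_iff.2 ⟨by simpa using hlen, hB⟩
      exact ⟨0, 1, rfl, .singleton _ n, .one n x k hnx hnx'⟩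

/-- A region that lasts at least one more move has two tips that may be joined. -/
theorem Lasts.exists_eq {E : Multiset (Sym2 ℕ)} {c : Cycle ℕ} {w : ℕ}
    (h : Lasts E c (w + 1)) : ∃ (a b : ℕ) (A B : List ℕ),
      c = (a :: A ++ b :: B : List ℕ) ∧ a ≠ b ∧ s(a, b) ∉ E := by
  generalize hw : w + 1 = w' at h
  cases h with
  | dead => omega
  | one u x k hne h => exact ⟨u, x, [], List.replicate k x, by simp [List.replicate_succ], hne, h⟩
  | two a b x k hne h => exact ⟨b, a, [], List.replicate (k + 1) x, rfl, hne.symm, Sym2.eq_swap ▸ h⟩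

/-- The graph is triangle-free and connected, and play lasts exactly `k` more moves, where the
components in `W` bound the regions and are listed with the number of moves left. -/
def PositionLasts (k : ℕ) (P : Position) : Prop :=
  TriangleFree P.numVertices P.edges ∧ ∃ W : Multiset (Cycle ℕ × ℕ),
    P.regions = W.map (fun c => {c.1}) ∧ (W.map Prod.snd).sum = k ∧
    ∀ c ∈ W, Lasts P.edges c.1 c.2 ∧ ∀ x ∈ c.1, x < P.numVertices

/-- Each region has a single boundary component, so only splits occur; the split region loses one
move and the others keep theirs. -/
theorem PositionLasts.move {k : ℕ} {P Q : Position} (h : PositionLasts k P)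
    (hPQ : Move (girthClass 4) P Q) : ∃ j, k = j + 1 ∧ PositionLasts j Q := by
  classical
  obtain ⟨htri, W, hW, hk, hl⟩ := h
  obtain ⟨hJ, hQ⟩ := hPQ
  cases hJ with
  | split n E R K L a b A B =>
    obtain ⟨⟨c, w⟩, hc, hcs, hR⟩ := (Multiset.map_eq_cons _ _ _ _).2 hW.symm
    obtain ⟨W, rfl⟩ := Multiset.exists_cons_of_mem hc
    rw [Multiset.erase_cons_head] at hR
    simp only [Multiset.singleton_eq_cons_iff] at hcs
    obtain ⟨rfl, hKL⟩ := hcs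
    obtain ⟨rfl, rfl⟩ : K = 0 ∧ L = 0 := by simpa [add_eq_zero] using hKL
    obtain ⟨hlast, hlt⟩ := hl _ hc
    have ha : a < n := hlt a (by simp)
    have hb : b < n := hlt b (by simp)
    obtain ⟨hne, hE⟩ := ne_and_notMem_of_graph_mem ha hb hQ
    obtain ⟨i, j, rfl, hi, hj⟩ := Lasts.split htri hlast hlt hne hE
    refine ⟨i + (j + (W.map Prod.snd).sum), ?_, htri.subdivide ha hb hne hE,
      ((n :: A : List ℕ), i) ::ₘ ((n :: B : List ℕ), j) ::ₘ W, ?_, by simp, ?_⟩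
    · simp at hk
      omega
    · simp [hR]
    · simp only [Multiset.mem_cons, forall_eq_or_imp]
      refine ⟨⟨hi, ?_⟩, ⟨hj, ?_⟩, fun c hc' => ?_⟩
      · intro x hx
        have := hlt x
        simp at hx this
        grind
      · intro x hx
        have := hlt x
        simp at hx this
        grind
      · obtain ⟨h1, h2⟩ := hl c (by simp [hc'])
        exact ⟨h1.subdivide h2 a b, fun x hx => (h2 x hx).trans n.lt_succ_self⟩
  | merge n E R K a b A B =>
    obtain ⟨c, hc, hcs, hR⟩ := (Multiset.map_eq_cons _ _ _ _).2 hW.symm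
    simpa using congrArg Multiset.card hcs

theorem PositionLasts.exists_move {k : ℕ} {P : Position} (h : PositionLasts (k + 1) P) :
    ∃ Q, Move (girthClass 4) P Q := by
  obtain ⟨htri, W, hW, hk, hl⟩ := h
  obtain ⟨⟨c, w⟩, hc, hw⟩ : ∃ c ∈ W, c.2 ≠ 0 := by
    by_contra! h0
    have : (W.map Prod.snd).sum = 0 := by
      rw [Multiset.sum_eq_zero_iff]
      simpa using fun _ c hc => h0 (c, _) hc
    omega
  obtain ⟨w, rfl⟩ := Nat.exists_eq_succ_of_ne_zero hw
  obtain ⟨W, rfl⟩ := Multiset.exists_cons_of_mem hc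
  obtain ⟨hlast, hlt⟩ := hl _ hc
  obtain ⟨a, b, A, B, rfl, hne, hE⟩ := hlast.exists_eq
  obtain ⟨n, E, R⟩ := P
  simp only [Multiset.map_cons] at hW hlt hE htri
  obtain rfl := hW
  refine ⟨⟨n + 1, subdivide n E a b, {((n :: A : List ℕ) : Cycle ℕ)} ::ₘ
    {((n :: B : List ℕ) : Cycle ℕ)} ::ₘ W.map fun c => {c.1}⟩, ?_, TriangleFree.graph_mem
      (htri.subdivide (hlt a (by simp)) (hlt b (by simp)) hne hE)⟩
  simpa using Join.split n E (W.map fun c => {c.1}) 0 0 a b A B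

theorem PositionLasts.hasNimber {k : ℕ} {P : Position} (h : PositionLasts k P) :
    HasNimber (Move (girthClass 4)) P (k % 2) :=
  hasNimber_mod_two PositionLasts (fun _ _ _ h => h.move) (fun _ _ h => h.exists_move) k P h

/-! ### Termination -/

/-- If the drawing is connected, then every position has a nimber. -/
theorem exists_hasNimber_of_card_eq_one (F : Set (Graph ℕ (Sym2 ℕ × ℕ))) (P : Position)
    (hP : ∀ r ∈ P.regions, r.card = 1) : ∃ m, HasNimber (Move F) P m := by
  -- The measure counts tips minus one per component: a split turns `|A| + |B| + 1` into `|A| +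
  -- |B|`.
  suffices hI : ∀ P Q : Position, (∀ r ∈ P.regions, r.card = 1) → Move F P Q →
      (∀ r ∈ Q.regions, r.card = 1) ∧
        (Q.regions.map fun r => (r.map fun c => c.length - 1).sum).sum <
          (P.regions.map fun r => (r.map fun c => c.length - 1).sum).sum by
    obtain ⟨m, -, h⟩ := exists_hasNimber _ _ hI P hP
    exact ⟨m, h⟩
  clear! P
  rintro P Q hP ⟨hJ, -⟩
  cases hJ with
  | split n E R K L a b A B =>
    simp only [Multiset.mem_cons, forall_eq_or_imp, Multiset.card_cons, Multiset.card_add] at hP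
    obtain ⟨rfl, rfl⟩ : K = 0 ∧ L = 0 := by
      rw [← Multiset.card_eq_zero, ← Multiset.card_eq_zero]
      omega
    refine ⟨by simpa using hP.2, ?_⟩
    simp
    omega
  | merge n E R K a b A B => simp at hP

/-! ### The first two moves -/

/-- The position after the only possible first move, which joins the two spots. -/
def afterFirst (p q : ℕ) : Position :=
  ⟨3, {s(0, 2), s(2, 1)},
    {{((2 :: List.replicate p 0 ++ 2 :: List.replicate q 1 : List ℕ) : Cycle ℕ)}}⟩

/-- The position after the reply that joins the two spots a second time, so that all other tips
of the first spot lie on one side of the resulting 4-cycle, and those of the second spot on the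
other side. -/
def afterReply (p q : ℕ) : Position :=
  ⟨4, {s(0, 3), s(3, 1), s(0, 2), s(2, 1)},
    {{((3 :: (List.replicate p 0 ++ [2]) : List ℕ) : Cycle ℕ)},
      {((3 :: (List.replicate q 1 ++ [2]) : List ℕ) : Cycle ℕ)}}⟩

theorem start_pair (p q : ℕ) : start ![p, q] =
    ⟨2, 0, {{((List.replicate p 0 : List ℕ) : Cycle ℕ), ((List.replicate q 1 : List ℕ) : Cycle ℕ)}}⟩ := by
  simp only [start, Position.mk.injEq, true_and]
  rfl

theorem coe_cons_eq_coe_replicate {x a p : ℕ} {A : List ℕ}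
    (h : ((a :: A : List ℕ) : Cycle ℕ) = (List.replicate (p + 1) x : List ℕ)) :
    a = x ∧ A = List.replicate p x := by
  have hp := (Cycle.coe_eq_coe.1 h).perm
  rw [List.perm_replicate, List.replicate_succ] at hp
  simpa using hp

theorem triangleFree_empty (n : ℕ) : TriangleFree n 0 := ⟨by simp, by simp, by simp⟩

theorem triangleFree_afterFirst (p q : ℕ) :
    TriangleFree (afterFirst p q).numVertices (afterFirst p q).edges :=
  (triangleFree_empty 2).subdivide (a := 0) (b := 1) (by simp) (by simp) (by simp) (by simp)

theorem triangleFree_afterReply (p q : ℕ) :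
    TriangleFree (afterReply p q).numVertices (afterReply p q).edges :=
  (triangleFree_afterFirst p q).subdivide (a := 0) (b := 1) (by simp [afterFirst])
    (by simp [afterFirst]) (by simp) (by simp [afterFirst])

theorem move_start_iff (p q : ℕ) (Q : Position) :
    Move (girthClass 4) (start ![p + 1, q + 1]) Q ↔ Q = afterFirst p q := by
  rw [start_pair]
  constructor
  · rintro ⟨hJ, hQ⟩
    generalize hP : Position.mk _ _ _ = P at hJ
    cases hJ with
    | split n E R K L a b A B =>
      simp only [Position.mk.injEq] at hP
      obtain ⟨rfl, rfl, hR⟩ := hP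
      rw [Multiset.singleton_eq_cons_iff] at hR
      obtain ⟨hR, rfl⟩ := hR
      have hmem : ((a :: A ++ b :: B : List ℕ) : Cycle ℕ) ∈
          ({((List.replicate (p + 1) 0 : List ℕ) : Cycle ℕ),
            ((List.replicate (q + 1) 1 : List ℕ) : Cycle ℕ)} : Multiset (Cycle ℕ)) := by
        rw [hR]
        simp
      have key : ∀ x m, x < 2 → ((a :: (A ++ b :: B) : List ℕ) : Cycle ℕ) ≠
          (List.replicate (m + 1) x : List ℕ) := by
        intro x m hx h
        obtain ⟨rfl, h⟩ := coe_cons_eq_coe_replicate h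
        have hb : b ∈ List.replicate m a := by
          rw [← h]
          simp
        obtain rfl := List.eq_of_mem_replicate hb
        exact (ne_and_notMem_of_graph_mem hx hx hQ).1 rfl
      simp only [Multiset.insert_eq_cons, Multiset.mem_cons, Multiset.mem_singleton,
        List.cons_append] at hmem
      rcases hmem with h | h
      · exact absurd h (key 0 p (by omega))
      · exact absurd h (key 1 q (by omega))
    | merge n E R K a b A B =>
      simp only [Position.mk.injEq] at hP
      obtain ⟨rfl, rfl, hR⟩ := hP
      rw [Multiset.singleton_eq_cons_iff] at hR
      obtain ⟨hR, rfl⟩ := hR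
      have hK : K = 0 := by
        have := congrArg Multiset.card hR
        simpa using this
      subst hK
      rw [Multiset.insert_eq_cons, Multiset.cons_eq_cons] at hR
      rcases hR with ⟨h1, h2⟩ | ⟨-, cs, h1, h2⟩
      · obtain ⟨rfl, rfl⟩ := coe_cons_eq_coe_replicate h1.symm
        obtain ⟨rfl, rfl⟩ := coe_cons_eq_coe_replicate (by simpa using h2.symm)
        rfl
      -- The spots appear in the opposite order; the result is the same up to rotating the cycle.
      · rw [Multiset.singleton_eq_cons_iff] at h1
        obtain ⟨h1, rfl⟩ := h1
        rw [Multiset.cons_inj_left] at h2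
        obtain ⟨rfl, rfl⟩ := coe_cons_eq_coe_replicate h1.symm
        obtain ⟨rfl, rfl⟩ := coe_cons_eq_coe_replicate h2
        have hE : (s(1, 2) ::ₘ s(2, 0) ::ₘ 0 : Multiset (Sym2 ℕ)) = {s(0, 2), s(2, 1)} := by
          rw [Sym2.eq_swap (a := 1), Sym2.eq_swap (b := 0), Multiset.cons_swap]
          rfl
        have hc : ((2 :: List.replicate q 1 ++ 2 :: List.replicate p 0 : List ℕ) : Cycle ℕ) =
            (2 :: List.replicate p 0 ++ 2 :: List.replicate q 1 : List ℕ) :=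
          Cycle.coe_eq_coe.2 List.isRotated_append
        rw [hE, hc]
        rfl
  · rintro rfl
    refine ⟨?_, (triangleFree_afterFirst p q).graph_mem⟩
    exact Join.merge 2 0 0 0 0 1 (List.replicate p 0) (List.replicate q 1)

theorem move_afterFirst (p q : ℕ) :
    Move (girthClass 4) (afterFirst (p + 1) (q + 1)) (afterReply p q) := by
  refine ⟨?_, (triangleFree_afterReply p q).graph_mem⟩
  have h := Join.split 3 {s(0, 2), s(2, 1)} 0 0 0 0 1 (List.replicate p 0 ++ [2])
    (List.replicate q 1 ++ [2])
  have hc : ((2 :: List.replicate (p + 1) 0 ++ 2 :: List.replicate (q + 1) 1 : List ℕ) : Cycle ℕ) =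
      (0 :: (List.replicate p 0 ++ [2]) ++ 1 :: (List.replicate q 1 ++ [2]) : List ℕ) := by
    -- Moving the leading `2` to the end shows that the joined tips are the ones right after the two
    -- tips of `2`.
    rw [List.cons_append, Cycle.coe_cons_eq_coe_append]
    simp [List.replicate_succ]
  rw [← hc] at h
  exact h

theorem positionLasts_afterReply (p q : ℕ) : PositionLasts 4 (afterReply (p + 1) (q + 1)) := by
  have hc : ∀ x k : ℕ, ((3 :: (List.replicate k x ++ [2]) : List ℕ) : Cycle ℕ) =
      (2 :: 3 :: List.replicate k x : List ℕ) := fun x k => by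
    rw [Cycle.coe_cons_eq_coe_append (a := 2)]
    rfl
  refine ⟨triangleFree_afterReply _ _,
    {(((3 :: (List.replicate (p + 1) 0 ++ [2]) : List ℕ) : Cycle ℕ), 2),
      (((3 :: (List.replicate (q + 1) 1 ++ [2]) : List ℕ) : Cycle ℕ), 2)}, rfl, rfl, ?_⟩
  simp only [Multiset.insert_eq_cons, Multiset.mem_cons, Multiset.mem_singleton, forall_eq_or_imp,
    forall_eq]
  refine ⟨⟨?_, ?_⟩, ?_, ?_⟩
  · rw [hc]
    exact .two 3 2 0 p (by simp) (by simp [afterReply]) (by simp [afterReply])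
      (by simp [afterReply]) (by simp) (by simp)
  · simp [afterReply]
  · rw [hc]
    exact .two 3 2 1 q (by simp) (by simp [afterReply]) (by simp [afterReply])
      (by simp [afterReply]) (by simp) (by simp)
  · simp [afterReply]

end BrusselsSprout

/-- Brussels sprout on triangle-free planar graphs, started from two spots with `p, q ≥ 3` open
tips, has nimber `0`: there is exactly one first move (up to symmetry), and the second player can
reply to it so that the resulting position has nimber `0`. -/
theorem theorem6 (p q : ℕ) (hp : 3 ≤ p) (hq : 3 ≤ q) :
    BrusselsSprout.HasNimber (BrusselsSprout.Move (BrusselsSprout.girthClass 4))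
        (BrusselsSprout.start ![p, q]) 0 ∧
      ∃ P₁ : BrusselsSprout.Position,
        (∀ Q, BrusselsSprout.Move (BrusselsSprout.girthClass 4)
          (BrusselsSprout.start ![p, q]) Q ↔ Q = P₁) ∧
        ∃ P₂ : BrusselsSprout.Position,
          BrusselsSprout.Move (BrusselsSprout.girthClass 4) P₁ P₂ ∧
          BrusselsSprout.HasNimber (BrusselsSprout.Move (BrusselsSprout.girthClass 4)) P₂ 0 := by
  -- Each of the first two moves uses one tip of each spot; the third guarantees a spare tip for
  -- `Lasts.two`.
  obtain ⟨p, rfl⟩ := Nat.exists_eq_add_of_le' hp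
  obtain ⟨q, rfl⟩ := Nat.exists_eq_add_of_le' hq
  have hfirst := BrusselsSprout.move_start_iff (p + 2) (q + 2)
  have hreply := BrusselsSprout.move_afterFirst (p + 1) (q + 1)
  have hzero := (BrusselsSprout.positionLasts_afterReply p q).hasNimber
  refine ⟨?_, _, hfirst, _, hreply, hzero⟩
  obtain ⟨m, hm⟩ := BrusselsSprout.exists_hasNimber_of_card_eq_one (BrusselsSprout.girthClass 4)
    (BrusselsSprout.afterFirst (p + 2) (q + 2)) (by simp [BrusselsSprout.afterFirst])
  -- The reply is an option of nimber `0`.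
  have hm0 : m ≠ 0 := by
    rintro rfl
    cases hm with
    | mk _ _ g children below avoid => exact avoid _ hreply ((children _ hreply).unique hzero)
  refine .mk _ _ (fun _ => m) (fun y hy => ?_) (fun k hk => absurd hk k.not_lt_zero)
    fun _ _ => hm0
  rw [(hfirst y).1 hy]
  exact hm
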